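/- Let $p\ge 0$ and $d_1,\dots,d_p$ be fixed integers, $r=\sum_{j=1}^p d_j$, and write vectors of $\mathbb R^r$ as $\beta=(\beta_1,\dots,\beta_p)$ with groups $\beta_j\in\mathbb R^{d_j}$; $\|\cdot\|$ is the Euclidean norm. For $n\ge 1$ consider the linear model $$Y_i=\mathbb X_i^t\beta^0+\varepsilon_i,\qquad i=1,\dots,n,$$ with true parameter $\beta^0\in\mathbb R^r$, deterministic design vectors $\mathbb X_i\in\mathbb R^r$ (which may depend on $n$) and random errors $\varepsilon_i$. Put $\mathcal A=\{j:\|\beta^0_j\|\ne 0\}$. Fix $\tau\in(0,1)$ and $\gamma>0$, let $\rho_\tau(u)=u(\tau-1_{u<0})$, let $\widetilde\beta_n$ be a quantile estimator, i.e. a minimizer over $\beta\in\mathbb R^r$ of $\sum_{i=1}^n\rho_\tau(Y_i-\mathbb X_i^t\beta)$, and let $\widehat\beta^*_n$ be an adaptive group LASSO quantile estimator, i.e. a minimizer over $\beta\in\mathbb R^r$ of $$Q(\beta)=\sum_{i=1}^n\rho_\tau(Y_i-\mathbb X_i^t\beta)+\mu_n\sum_{j=1}^p\widehat\omega_{n;j}\|\beta_j\|,\qquad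 \widehat\omega_{n;j}=\|\widetilde\beta_{n;j}\|^{-\gamma},$$ (with $\widehat\omega_{n;j}=\infty$ if $\widetilde\beta_{n;j}=0$, and $\infty\cdot 0=0$). Put $\widehat{\mathcal A}^*_n=\{j:\|\widehat\beta^*_{n;j}\|\neq 0\}$. Assume: (A1) $n^{-1}\max_{1\le i\le n}\mathbb X_i^t\mathbb X_i\to 0$ and $n^{-1}\sum_{i=1}^n\mathbb X_i\mathbb X_i^t\to\Upsilon$ as $n\to\infty$, with $\Upsilon$ an $r\times r$ positive definite matrix. (A2) The errors $\varepsilon_i$ are independent and identically distributed, with distribution function $F$ that has a continuous positive density $f$ in a neighbourhood of $0$, and $F(0)=\tau$. Moreover, for a set $\mathcal B\subseteq\mathbb R$ with $0\in\mathcal B$ and for every $e$ in the interior of $\mathcal B$, $$\lim_{n\to\infty}n^{-1}\sum_{i=1}^n\int_0^{\mathbb X_i^t\mathbf 1_r}\sqrt n\,\bigl[F(e+v/\sqrt n)-F(e)\bigr]\,dv=\tfrac12 f(e)\,\mathbf 1_r^t\Upsilon\mathbf 1_r,$$ where $\mathbf 1_r$ is the $r$-vector with all components $1$. The tuning parameters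 $\mu_n$ satisfy, as $n\to\infty$, $\mu_n\to\infty$, $\mu_n/\sqrt n\to 0$, $n^{(\gamma-1)/2}\mu_n\to\infty$ and $n^{\gamma/2-1}\mu_n\to\infty$. Then $\lim_{n\to\infty}\mathbb P[\widehat{\mathcal A}^*_n=\mathcal A]=1$. -/

import Mathlib

open Filter Topology MeasureTheory ProbabilityTheory

noncomputable section

/-- Vectors of `ℝ^r`, `r = d_1 + ⋯ + d_p`, split into `p` groups; the `j`th group is a vector of
the Euclidean space `ℝ^(d_j)`. Both the parameters and the explanatory variables of one observation
are of this type. -/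
abbrev GroupedVec {p : ℕ} (d : Fin p → ℕ) : Type :=
  (j : Fin p) → EuclideanSpace ℝ (Fin (d j))

/-- The check function `ρ_τ(u) = u (τ - 1_{u < 0})`. -/
def checkFun (τ u : ℝ) : ℝ := u * (τ - if u < 0 then 1 else 0)

/-- The linear predictor `𝕏ᵗ β = ∑_j X_jᵗ β_j`. -/
def linPred {p : ℕ} {d : Fin p → ℕ} (x b : GroupedVec d) : ℝ :=
  ∑ j, inner ℝ (x j) (b j)

/-- The responses `Y_i = 𝕏_iᵗ β⁰ + ε_i`, `i < n`, of the linear model with `n` observations. -/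
def response {p : ℕ} {d : Fin p → ℕ} {Ω : Type*} {n : ℕ} (x : Fin n → GroupedVec d)
    (b₀ : GroupedVec d) (ε : ℕ → Ω → ℝ) (ω : Ω) (i : Fin n) : ℝ :=
  linPred (x i) b₀ + ε i ω

/-- The quantile process `∑_i ρ_τ(Y_i - 𝕏_iᵗ β)`. -/
def quantileProcess {p : ℕ} {d : Fin p → ℕ} {n : ℕ} (τ : ℝ) (x : Fin n → GroupedVec d)
    (Y : Fin n → ℝ) (b : GroupedVec d) : ℝ :=
  ∑ i, checkFun τ (Y i - linPred (x i) b)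

/-- `b` is a quantile estimate: a minimizer of the quantile process over all of `ℝ^r`. -/
def IsQuantileEstimate {p : ℕ} {d : Fin p → ℕ} {n : ℕ} (τ : ℝ) (x : Fin n → GroupedVec d)
    (Y : Fin n → ℝ) (b : GroupedVec d) : Prop :=
  IsMinOn (quantileProcess τ x Y) Set.univ b

/-- The adaptive weight `‖β̃_j‖^(-γ)` of group `j`. It takes values in `[0, ∞]`, and for `γ > 0`
it is `∞` if `β̃_j = 0`. -/
def adaptiveWeight {p : ℕ} {d : Fin p → ℕ} (γ : ℝ) (bt : GroupedVec d) (j : Fin p) : ENNReal :=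
  ‖bt j‖ₑ ^ (-γ)

/-- The quantile process penalized by the adaptive group LASSO penalty,
`Q(β) = ∑_i ρ_τ(Y_i - 𝕏_iᵗ β) + μ ∑_j ω̂_j ‖β_j‖`, with values in `[0, ∞]` and `∞ · 0 = 0`: a group
of infinite weight contributes `0` if `β_j = 0`, and `∞` otherwise. -/
def penalizedProcess {p : ℕ} {d : Fin p → ℕ} {n : ℕ} (τ γ μ : ℝ) (x : Fin n → GroupedVec d)
    (Y : Fin n → ℝ) (bt b : GroupedVec d) : ENNReal :=
  ENNReal.ofReal (quantileProcess τ x Y b)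
    + ENNReal.ofReal μ * ∑ j, adaptiveWeight γ bt j * ‖b j‖ₑ

/-- `b` is an adaptive group LASSO quantile estimate, for the weights given by `bt`: a minimizer
of the penalized process over all of `ℝ^r`. -/
def IsAdaptiveGroupLassoEstimate {p : ℕ} {d : Fin p → ℕ} {n : ℕ} (τ γ μ : ℝ)
    (x : Fin n → GroupedVec d) (Y : Fin n → ℝ) (bt b : GroupedVec d) : Prop :=
  IsMinOn (penalizedProcess τ γ μ x Y bt) Set.univ b

/-- The index set of the nonzero groups of a vector. -/
def activeGroups {p : ℕ} {d : Fin p → ℕ} (b : GroupedVec d) : Set (Fin p) :=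
  {j | ‖b j‖ ≠ 0}

/-- The `r × r` matrix `n⁻¹ ∑_i 𝕏_i 𝕏_iᵗ`. -/
def designGram {p : ℕ} {d : Fin p → ℕ} {n : ℕ} (x : Fin n → GroupedVec d) :
    Matrix (Σ j, Fin (d j)) (Σ j, Fin (d j)) ℝ :=
  Matrix.of fun a b => (n : ℝ)⁻¹ * ∑ i, x i a.1 a.2 * x i b.1 b.2

/-- Assumption on the (deterministic) design, where `X n i` is the `i`th row of the design with
`n` observations:
`n⁻¹ max_i 𝕏_iᵗ 𝕏_i → 0` and `n⁻¹ ∑_i 𝕏_i 𝕏_iᵗ → U` with `U` positive definite. -/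
structure DesignAssumption {p : ℕ} {d : Fin p → ℕ} (X : (n : ℕ) → Fin n → GroupedVec d)
    (U : Matrix (Σ j, Fin (d j)) (Σ j, Fin (d j)) ℝ) : Prop where
  max_tendsto : Tendsto (fun n : ℕ => (n : ℝ)⁻¹ * ⨆ i : Fin n, linPred (X n i) (X n i))
    atTop (𝓝 0)
  gram_tendsto : Tendsto (fun n : ℕ => designGram (X n)) atTop (𝓝 U)
  posDef : U.PosDef

/-- `𝕏ᵗ 1_r`, the sum of all the coordinates of a vector. -/
def coordSum {p : ℕ} {d : Fin p → ℕ} (x : GroupedVec d) : ℝ := ∑ j, ∑ k, x j k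

/-- Assumption on the errors. They are i.i.d., with distribution function `F = cdf (law of ε_0)`
that has, in a neighbourhood of `0`, a continuous positive density `f`; their `τ`th quantile
is `0`, that is `F(0) = τ`; and, for every `e` in the interior of the set `B`,
`n⁻¹ ∑_i ∫_0^{𝕏_iᵗ 1_r} √n [F(e + v/√n) - F(e)] dv → f(e) 1_rᵗ U 1_r / 2`. -/
structure ErrorAssumption {p : ℕ} {d : Fin p → ℕ} {Ω : Type*} [MeasurableSpace Ω] (P : Measure Ω)
    (ε : ℕ → Ω → ℝ) (τ : ℝ) (f : ℝ → ℝ) (B : Set ℝ) (X : (n : ℕ) → Fin n → GroupedVec d)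
    (U : Matrix (Σ j, Fin (d j)) (Σ j, Fin (d j)) ℝ) : Prop where
  indep : iIndepFun ε P
  identDistrib : ∀ i, IdentDistrib (ε i) (ε 0) P P
  density : ∃ V : Set ℝ, IsOpen V ∧ (0 : ℝ) ∈ V ∧ ContinuousOn f V ∧ (∀ v ∈ V, 0 < f v) ∧
    (P.map (ε 0)).restrict V = (volume.restrict V).withDensity (fun v => ENNReal.ofReal (f v))
  quantile : cdf (P.map (ε 0)) 0 = τ
  zero_mem : (0 : ℝ) ∈ B
  integral_tendsto : ∀ e ∈ interior B,
    Tendsto (fun n : ℕ => (n : ℝ)⁻¹ * ∑ i : Fin n, ∫ v in (0 : ℝ)..coordSum (X n i),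
        √(n : ℝ) * (cdf (P.map (ε 0)) (e + v / √(n : ℝ)) - cdf (P.map (ε 0)) e))
      atTop (𝓝 (1 / 2 * f e * ∑ a, ∑ b, U a b))

end

/-! With `u = √n (β - β⁰)`, Knight's identity splits the increment of the quantile process from `β⁰`
into a linear score term, of mean zero and bounded in probability, and a nonnegative remainder. The
density is bounded below near `0`, so the remainder is at least a multiple of `‖u‖²`. On a large
sphere the remainder wins, and convexity carries the bound outwards: with probability close to one
the increment is at least `‖u‖` whenever `‖u‖ ≥ C` (`exists_radius_growth`).

On that event selection is deterministic (`activeGroups_eq_of_growth`). The pilot estimate is within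
`C / √n` of `β⁰`, so active weights stay bounded. As `μ / √n → 0`, the penalty can move the LASSO
estimate only slightly, and no active group vanishes. An inactive group has weight at least `(C /
√n) ^ (-γ)`, while deleting it raises the quantile process by at most `O(n)` times its norm. Since
`n ^ (γ / 2 - 1) * μ → ∞`, deletion lowers the criterion unless the group is already zero
(`IsAdaptiveGroupLassoEstimate.eq_zero_of_lt`). No limit law or subgradient condition is needed. -/

/-! ### The check function and Knight's identity. -/

section CheckFunction

variable {τ : ℝ}

theorem checkFun_eq_max (u : ℝ) : checkFun τ u = max (τ * u) ((τ - 1) * u) := by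
  unfold checkFun
  split_ifs with h
  · rw [max_eq_right (by linarith)]; ring
  · rw [max_eq_left (by linarith)]; ring

theorem checkFun_nonneg (hτ₀ : 0 < τ) (hτ₁ : τ < 1) (u : ℝ) : 0 ≤ checkFun τ u := by
  rw [checkFun_eq_max]
  rcases le_total 0 u with h | h
  · exact le_max_of_le_left (by positivity)
  · exact le_max_of_le_right (by nlinarith)

theorem convexOn_checkFun (τ : ℝ) : ConvexOn ℝ Set.univ (checkFun τ) := by
  have h : checkFun τ = (fun u => τ * u) ⊔ (fun u => (τ - 1) * u) := by
    ext u; exact checkFun_eq_max u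
  rw [h]
  exact ((LinearMap.mulLeft ℝ τ).convexOn convex_univ).sup
    ((LinearMap.mulLeft ℝ (τ - 1)).convexOn convex_univ)

theorem checkFun_sub_le (hτ₀ : 0 < τ) (hτ₁ : τ < 1) (u v : ℝ) :
    checkFun τ u - checkFun τ v ≤ |u - v| := by
  have h1 := le_abs_self (u - v)
  have h2 := neg_abs_le (u - v)
  have h3 := abs_nonneg (u - v)
  simp only [checkFun_eq_max]
  rw [sub_le_iff_le_add]
  refine max_le ?_ ?_
  · have := le_max_left (τ * v) ((τ - 1) * v); nlinarith
  · have := le_max_right (τ * v) ((τ - 1) * v); nlinarith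

/-- The derivative `τ - 1_{u < 0}` of the check function. -/
noncomputable def checkScore (τ u : ℝ) : ℝ := τ - if u < 0 then 1 else 0

theorem measurable_checkScore (τ : ℝ) : Measurable (checkScore τ) :=
  measurable_const.sub (Measurable.ite measurableSet_Iio measurable_const measurable_const)

theorem abs_checkScore_le (hτ₀ : 0 < τ) (hτ₁ : τ < 1) (u : ℝ) : |checkScore τ u| ≤ 1 := by
  unfold checkScore
  rw [abs_le]
  split_ifs <;> constructor <;> linarith

/-- The remainder `∫_0^a (1_{e ≤ s} - 1_{e ≤ 0}) ds` in Knight's identity. -/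
noncomputable def knightRemainder (e a : ℝ) : ℝ := if e < 0 then max (e - a) 0 else max (a - e) 0

/-- Knight's identity. The remainder vanishes unless `e` lies between `0` and `a`, so it feels only
the law of the errors near `0`. -/
theorem checkFun_sub_eq (τ e a : ℝ) :
    checkFun τ (e - a) - checkFun τ e = knightRemainder e a - checkScore τ e * a := by
  unfold checkFun knightRemainder checkScore
  split_ifs with h1 h2 h2
  · rw [max_eq_right (by linarith)]; ring
  · rw [max_eq_left (by linarith)]; ring
  · rw [max_eq_left (by linarith)]; ring
  · rw [max_eq_right (by linarith)]; ring

theorem knightRemainder_nonneg (e a : ℝ) : 0 ≤ knightRemainder e a := by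
  unfold knightRemainder; split_ifs <;> exact le_max_right _ _

/-- The values of the error between `0` and `a / 2`. -/
noncomputable def halfway (a : ℝ) : Set ℝ := if 0 < a then Set.Ioc 0 (a / 2) else Set.Ico (a / 2) 0

theorem measurableSet_halfway (a : ℝ) : MeasurableSet (halfway a) := by
  unfold halfway; split_ifs <;> measurability

theorem halfway_subset {a δ : ℝ} (h : |a| ≤ δ) : halfway a ⊆ Set.Icc (-δ) δ := by
  obtain ⟨h1, h2⟩ := abs_le.1 h
  unfold halfway
  split_ifs with h0 <;> rintro x ⟨hx1, hx2⟩ <;> constructor <;> linarith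

theorem volume_halfway (a : ℝ) : volume.real (halfway a) = |a| / 2 := by
  unfold halfway
  split_ifs with h
  · rw [Real.volume_real_Ioc_of_le (by linarith), abs_of_pos h]; ring
  · rw [Real.volume_real_Ico_of_le (by linarith), abs_of_nonpos (by linarith)]; ring

/-- For `e` between `0` and `a / 2` the remainder is the distance from `e` to `a`. The moments of
the minorant reduce to the probability of an interval. -/
theorem indicator_halfway_le_knightRemainder (e a : ℝ) :
    (halfway a).indicator (fun _ => |a| / 2) e ≤ knightRemainder e a := by
  by_cases he : e ∈ halfway a
  · rw [Set.indicator_of_mem he]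
    unfold halfway at he
    unfold knightRemainder
    split_ifs at he with h
    · rw [if_neg (by linarith [he.1]), abs_of_pos h]
      exact le_max_of_le_left (by linarith [he.2])
    · rw [if_pos he.2, abs_of_nonpos (by linarith)]
      exact le_max_of_le_left (by linarith [he.1])
  · rw [Set.indicator_of_notMem he]; exact knightRemainder_nonneg e a

/-- The remainder is 1-Lipschitz in `a`, and zero for `|a| ≤ t < |e|`. The indicator gains a factor
of order `t` in the mean, which keeps the summed Lipschitz constants bounded. -/
theorem knightRemainder_sub_le {e a a' t : ℝ} (ha : |a| ≤ t) (ha' : |a'| ≤ t) :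
    knightRemainder e a - knightRemainder e a'
      ≤ |a - a'| * (Set.Icc (-t) t).indicator (fun _ => (1 : ℝ)) e := by
  obtain ⟨h1, h2⟩ := abs_le.1 ha
  obtain ⟨h3, h4⟩ := abs_le.1 ha'
  have h5 := le_abs_self (a - a')
  have h6 := neg_abs_le (a - a')
  have h7 := abs_nonneg (a - a')
  unfold knightRemainder
  by_cases he : e ∈ Set.Icc (-t) t
  · rw [Set.indicator_of_mem he, mul_one]
    split_ifs
    · have := le_max_left (e - a') 0
      have := le_max_right (e - a') 0
      have : max (e - a) 0 ≤ |a - a'| + max (e - a') 0 := max_le (by linarith) (by linarith)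
      linarith
    · have := le_max_left (a' - e) 0
      have := le_max_right (a' - e) 0
      have : max (a - e) 0 ≤ |a - a'| + max (a' - e) 0 := max_le (by linarith) (by linarith)
      linarith
  · rw [Set.indicator_of_notMem he, mul_zero]
    split_ifs with h
    · have : e < -t := by
        by_contra hc
        exact he ⟨not_lt.1 hc, by linarith⟩
      rw [max_eq_right (by linarith), max_eq_right (by linarith)]; simp
    · have : t < e := by
        by_contra hc
        exact he ⟨by linarith, not_lt.1 hc⟩
      rw [max_eq_right (by linarith), max_eq_right (by linarith)]; simp

end CheckFunction

/-! ### The law of the errors near zero. -/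

section ErrorLaw

/-- A density that is continuous and positive near `0` is bounded away from `0` and `∞` there. -/
theorem exists_density_bounds {ν : Measure ℝ} {f : ℝ → ℝ}
    {V : Set ℝ} (hV : IsOpen V) (h0 : (0 : ℝ) ∈ V) (hf : ContinuousOn f V)
    (hpos : ∀ v ∈ V, 0 < f v)
    (hν : ν.restrict V = (volume.restrict V).withDensity (fun v => ENNReal.ofReal (f v))) :
    ∃ δ > 0, ∃ m > 0, ∃ M > 0, ∀ I : Set ℝ, MeasurableSet I → I ⊆ Set.Icc (-δ) δ →
      m * volume.real I ≤ ν.real I ∧ ν.real I ≤ M * volume.real I := by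
  have hc : ContinuousAt f 0 := hf.continuousAt (hV.mem_nhds h0)
  have hf0 := hpos 0 h0
  have hev : {x | x ∈ V ∧ f 0 / 2 < f x ∧ f x < 2 * f 0} ∈ 𝓝 (0 : ℝ) :=
    Filter.Eventually.and (hV.mem_nhds h0) ((hc.eventually (lt_mem_nhds (half_lt_self hf0))).and
      (hc.eventually (gt_mem_nhds (by linarith))))
  obtain ⟨δ, hδ, hball⟩ := Metric.nhds_basis_closedBall.mem_iff.1 hev
  rw [Real.closedBall_eq_Icc, zero_sub, zero_add] at hball
  refine ⟨δ, hδ, f 0 / 2, by positivity, 2 * f 0, by positivity, fun I hI hIs => ?_⟩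
  have hIV : I ⊆ V := fun x hx => (hball (hIs hx)).1
  have hνI : ν I = ∫⁻ x in I, ENNReal.ofReal (f x) := by
    have h := congrArg (fun κ : Measure ℝ => κ I) hν
    simp only [Measure.restrict_apply hI, Set.inter_eq_left.2 hIV, withDensity_apply _ hI,
      Measure.restrict_restrict hI] at h
    exact h
  have hfin : volume I ≠ ⊤ := measure_ne_top_of_subset hIs (by simp)
  have hup : ν I ≤ ENNReal.ofReal (2 * f 0) * volume I := by
    rw [hνI, ← setLIntegral_const]
    exact setLIntegral_mono' hI fun x hx => ENNReal.ofReal_le_ofReal (hball (hIs hx)).2.2.le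
  have hlo : ENNReal.ofReal (f 0 / 2) * volume I ≤ ν I := by
    rw [hνI, ← setLIntegral_const]
    exact setLIntegral_mono' hI fun x hx => ENNReal.ofReal_le_ofReal (hball (hIs hx)).2.1.le
  have hfin' : ENNReal.ofReal (2 * f 0) * volume I ≠ ⊤ := ENNReal.mul_ne_top ENNReal.ofReal_ne_top hfin
  constructor
  · have := ENNReal.toReal_mono (ne_top_of_le_ne_top hfin' hup) hlo
    rwa [ENNReal.toReal_mul, ENNReal.toReal_ofReal (by positivity)] at this
  · have := ENNReal.toReal_mono hfin' hup
    rwa [ENNReal.toReal_mul, ENNReal.toReal_ofReal (by positivity)] at this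

/-- The score jumps on `Iio 0` while `cdf` measures `Iic 0`; the absence of an atom reconciles them.
-/
theorem integral_checkScore {ν : Measure ℝ} [IsProbabilityMeasure ν] {τ : ℝ}
    (hτ : cdf ν 0 = τ) (h0 : ν.real {0} = 0) : ∫ e, checkScore τ e ∂ν = 0 := by
  have h1 : ν.real (Set.Iio 0) = τ := by
    rw [← hτ, cdf_eq_real, ← Set.Iio_union_right, measureReal_union (by simp) (by simp), h0,
      add_zero]
  have h2 : checkScore τ = fun e => τ - (Set.Iio (0 : ℝ)).indicator (fun _ => (1 : ℝ)) e := by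
    ext e; simp [checkScore, Set.indicator]
  rw [h2, integral_sub (integrable_const _)
    ((integrable_const _).indicator measurableSet_Iio), integral_indicator_const _ measurableSet_Iio]
  simp [h1]

end ErrorLaw

/-! ### Chebyshev bounds for the score and the Knight remainder. -/

section LinearPerturbations

variable {Ω : Type*} [MeasurableSpace Ω] {P : Measure Ω} [IsProbabilityMeasure P] {ε : ℕ → Ω → ℝ}

/-- Chebyshev's inequality: by independence variances add, and each is at most a second moment. -/
theorem measure_abs_sum_sub_ge_le (hind : iIndepFun ε P)
    (hid : ∀ i, IdentDistrib (ε i) (ε 0) P P) {n : ℕ} {h : Fin n → ℝ → ℝ}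
    (hm : ∀ i, Measurable (h i)) {A : Fin n → ℝ} (hA : ∀ i e, |h i e| ≤ A i) {s : ℝ} (hs : 0 < s) :
    P {ω | s ≤ |∑ i, h i (ε i ω) - ∑ i, ∫ e, h i e ∂(P.map (ε 0))|}
      ≤ ENNReal.ofReal ((∑ i, ∫ e, h i e ^ 2 ∂(P.map (ε 0))) / s ^ 2) := by
  have hε : ∀ i, AEMeasurable (ε i) P := fun i => (hid i).aemeasurable_fst
  have hmem : ∀ i : Fin n, MemLp (h i ∘ ε i) 2 P := fun i =>
    MemLp.of_bound ((hm i).comp_aemeasurable (hε i)).aestronglyMeasurable (A i)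
      (Eventually.of_forall fun ω => hA i _)
  have hmap : ∀ i : ℕ, P.map (ε i) = P.map (ε 0) := fun i => (hid i).map_eq
  have hind' : iIndepFun (fun i : Fin n => h i ∘ ε i) P :=
    (hind.precomp Fin.val_injective).comp h hm
  have hmean : ∀ i : Fin n, ∫ ω, (h i ∘ ε i) ω ∂P = ∫ e, h i e ∂(P.map (ε 0)) := fun i => by
    rw [← hmap i, integral_map (hε i) (hm i).aestronglyMeasurable]; rfl
  have hvar : variance (∑ i : Fin n, h i ∘ ε i) P ≤ ∑ i, ∫ e, h i e ^ 2 ∂(P.map (ε 0)) := by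
    rw [IndepFun.variance_sum (fun i _ => hmem i) fun i _ j _ hij => hind'.indepFun hij]
    refine Finset.sum_le_sum fun i _ => ?_
    refine (variance_le_expectation_sq (hmem i).1).trans (le_of_eq ?_)
    rw [← hmap i, integral_map (hε i) ((hm i).pow_const 2).aestronglyMeasurable]; rfl
  have hcheb := meas_ge_le_variance_div_sq (memLp_finsetSum' Finset.univ fun i _ => hmem i) hs
  have hint : ∫ ω, (∑ i : Fin n, h i ∘ ε i) ω ∂P = ∑ i, ∫ e, h i e ∂(P.map (ε 0)) := by
    simp only [Finset.sum_apply]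
    rw [integral_finsetSum _ fun i _ => (hmem i).integrable (by norm_num)]
    exact Finset.sum_congr rfl fun i _ => hmean i
  rw [hint] at hcheb
  simp only [Finset.sum_apply, Function.comp_apply] at hcheb
  exact hcheb.trans (ENNReal.ofReal_le_ofReal (by gcongr))

variable {E : Type*} [NormedAddCommGroup E] [NormedSpace ℝ E]
  {l : (n : ℕ) → Fin n → E →L[ℝ] ℝ} {K : ℝ}

/-- The score process `∑_i ψ_τ(ε_i) l_i` is bounded in probability. -/
theorem exists_bound_score [FiniteDimensional ℝ E] (hind : iIndepFun ε P)
    (hid : ∀ i, IdentDistrib (ε i) (ε 0) P P) {τ : ℝ} (hτ₀ : 0 < τ) (hτ₁ : τ < 1)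
    (hmean : ∫ e, checkScore τ e ∂(P.map (ε 0)) = 0)
    (hK₀ : 0 ≤ K) (hK : ∀ᶠ n in atTop, ∑ i, ‖l n i‖ ^ 2 ≤ K) {η : ℝ} (hη : 0 < η) :
    ∃ R > 0, ∀ᶠ n in atTop,
      P {ω | R < ‖∑ i : Fin n, checkScore τ (ε i ω) • l n i‖} ≤ ENNReal.ofReal η := by
  have : IsProbabilityMeasure (P.map (ε 0)) :=
    Measure.isProbabilityMeasure_map (hid 0).aemeasurable_fst
  let b := Module.finBasis ℝ E
  -- In finite dimension a functional is controlled by its values on a basis, so scalar Chebyshev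
  -- bounds suffice.
  obtain ⟨C, hC, hCb⟩ := b.exists_opNorm_le (F := ℝ)
  set D : ℝ := ∑ k, K * ‖b k‖ ^ 2 with hD
  have hD0 : 0 ≤ D := Finset.sum_nonneg fun k _ => by positivity
  -- As `s ≥ 1`, `D / s ^ 2 ≤ D / s ≤ η`.
  set s : ℝ := 1 + D / η with hs
  have hs1 : 1 ≤ s := by rw [hs]; linarith [div_nonneg hD0 hη.le]
  have hs0 : 0 < s := by linarith
  have hDs : D / s ^ 2 ≤ η := by
    rw [div_le_iff₀ (by positivity)]
    have h1 : D = η * (D / η) := by field_simp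
    have h2 : D / η ≤ s := by rw [hs]; linarith
    calc D = η * (D / η) := h1
      _ ≤ η * s ^ 2 := by
        gcongr
        nlinarith
  refine ⟨C * s, by positivity, ?_⟩
  filter_upwards [hK] with n hn
  have hcheb : ∀ k, P {ω | s ≤ |∑ i : Fin n, checkScore τ (ε i ω) * l n i (b k)|}
      ≤ ENNReal.ofReal (K * ‖b k‖ ^ 2 / s ^ 2) := by
    intro k
    have h := measure_abs_sum_sub_ge_le hind hid (n := n)
      (h := fun i e => checkScore τ e * l n i (b k)) (A := fun i => |l n i (b k)|)
      (fun i => (measurable_checkScore τ).mul_const _)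
      (fun i e => by
        rw [abs_mul]
        exact mul_le_of_le_one_left (abs_nonneg _) (abs_checkScore_le hτ₀ hτ₁ e)) hs0
    simp only [integral_mul_const, hmean, zero_mul, Finset.sum_const_zero, sub_zero] at h
    refine h.trans (ENNReal.ofReal_le_ofReal ?_)
    gcongr
    calc ∑ i, ∫ e, (checkScore τ e * l n i (b k)) ^ 2 ∂(P.map (ε 0))
        ≤ ∑ i, ‖l n i‖ ^ 2 * ‖b k‖ ^ 2 := by
          refine Finset.sum_le_sum fun i _ => ?_
          have hle : ∀ e, (checkScore τ e * l n i (b k)) ^ 2 ≤ ‖l n i‖ ^ 2 * ‖b k‖ ^ 2 := by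
            intro e
            rw [← sq_abs, abs_mul, ← mul_pow]
            refine pow_le_pow_left₀ (by positivity) ?_ 2
            calc _ ≤ 1 * |l n i (b k)| := by
                  gcongr; exact abs_checkScore_le hτ₀ hτ₁ e
              _ ≤ _ := by rw [one_mul]; exact (l n i).le_opNorm (b k)
          calc _ ≤ ∫ _, ‖l n i‖ ^ 2 * ‖b k‖ ^ 2 ∂(P.map (ε 0)) := by
                refine integral_mono_of_nonneg (Eventually.of_forall fun e => sq_nonneg _)
                  (integrable_const _) (Eventually.of_forall hle)
            _ = _ := by simp
      _ = (∑ i, ‖l n i‖ ^ 2) * ‖b k‖ ^ 2 := by rw [Finset.sum_mul]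
      _ ≤ K * ‖b k‖ ^ 2 := by gcongr
  calc P {ω | C * s < ‖∑ i : Fin n, checkScore τ (ε i ω) • l n i‖}
      ≤ P (⋃ k, {ω | s ≤ |∑ i : Fin n, checkScore τ (ε i ω) * l n i (b k)|}) := by
        refine measure_mono fun ω hω => ?_
        by_contra hcon
        simp only [Set.mem_iUnion, Set.mem_ofPred_eq, not_exists, not_le] at hcon
        refine absurd hω (not_lt.2 (hCb hs0.le fun k => ?_))
        simpa using (hcon k).le
    _ ≤ ∑ k, P {ω | s ≤ |∑ i : Fin n, checkScore τ (ε i ω) * l n i (b k)|} :=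
        measure_iUnion_fintype_le _ _
    _ ≤ ∑ k, ENNReal.ofReal (K * ‖b k‖ ^ 2 / s ^ 2) := Finset.sum_le_sum fun k _ => hcheb k
    _ = ENNReal.ofReal (D / s ^ 2) := by
        rw [← ENNReal.ofReal_sum_of_nonneg fun k _ => by positivity, hD, Finset.sum_div]
    _ ≤ ENNReal.ofReal η := ENNReal.ofReal_le_ofReal hDs

variable {δ m M : ℝ}

/-- The Lipschitz constant of the Knight remainder on a ball of radius `C` is bounded in
probability. -/
theorem exists_bound_lipschitz (hind : iIndepFun ε P)
    (hid : ∀ i, IdentDistrib (ε i) (ε 0) P P)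
    (hδ : 0 < δ) (hM : 0 < M)
    (hdens : ∀ I : Set ℝ, MeasurableSet I → I ⊆ Set.Icc (-δ) δ →
      (P.map (ε 0)).real I ≤ M * volume.real I)
    (hmax : ∀ r > 0, ∀ᶠ n in atTop, ∀ i, ‖l n i‖ ≤ r)
    (hK₀ : 0 ≤ K) (hK : ∀ᶠ n in atTop, ∑ i, ‖l n i‖ ^ 2 ≤ K)
    {C : ℝ} (hC : 0 < C) {η : ℝ} (hη : 0 < η) :
    ∃ R > 0, ∀ᶠ n in atTop,
      P {ω | R ≤ ∑ i, ‖l n i‖ * (Set.Icc (-(C * ‖l n i‖)) (C * ‖l n i‖)).indicator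
        (fun _ => (1 : ℝ)) (ε i ω)} ≤ ENNReal.ofReal η := by
  have : IsProbabilityMeasure (P.map (ε 0)) :=
    Measure.isProbabilityMeasure_map (hid 0).aemeasurable_fst
  set s : ℝ := 1 + K / η with hs
  have hs1 : 1 ≤ s := by rw [hs]; linarith [div_nonneg hK₀ hη.le]
  have hs0 : 0 < s := by linarith
  have hKs : K / s ^ 2 ≤ η := by
    rw [div_le_iff₀ (by positivity)]
    have h1 : K = η * (K / η) := by field_simp
    have h2 : K / η ≤ s := by rw [hs]; linarith
    calc K = η * (K / η) := h1
      _ ≤ η * s ^ 2 := by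
        gcongr
        nlinarith
  -- The first term bounds the mean, an interval of length `2 C ‖l n i‖` having probability at most
  -- `2 M C ‖l n i‖`; `s` is the allowed deviation.
  refine ⟨2 * M * C * K + s, by positivity, ?_⟩
  filter_upwards [hK, hmax (δ / C) (by positivity)] with n hn hn'
  have h := measure_abs_sum_sub_ge_le hind hid (n := n)
    (h := fun i e => ‖l n i‖ * (Set.Icc (-(C * ‖l n i‖)) (C * ‖l n i‖)).indicator
        (fun _ => (1 : ℝ)) e) (A := fun i => ‖l n i‖)
    (fun i => (measurable_const.indicator measurableSet_Icc).const_mul _)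
    (fun i e => by
      rw [abs_mul, abs_norm]
      refine mul_le_of_le_one_right (norm_nonneg _) ?_
      by_cases he : e ∈ Set.Icc (-(C * ‖l n i‖)) (C * ‖l n i‖) <;> simp [he]) hs0
  have hmean : ∑ i, ∫ e, ‖l n i‖ * (Set.Icc (-(C * ‖l n i‖)) (C * ‖l n i‖)).indicator
        (fun _ => (1 : ℝ)) e ∂(P.map (ε 0)) ≤ 2 * M * C * K := by
    calc _ ≤ ∑ i, 2 * M * C * ‖l n i‖ ^ 2 := by
          refine Finset.sum_le_sum fun i _ => ?_
          have hCl : C * ‖l n i‖ ≤ δ := by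
            have := hn' i
            rw [le_div_iff₀ hC] at this; linarith
          have hb := hdens (Set.Icc (-(C * ‖l n i‖)) (C * ‖l n i‖)) measurableSet_Icc
            (Set.Icc_subset_Icc (by linarith) hCl)
          rw [Real.volume_real_Icc_of_le (by linarith [mul_nonneg hC.le (norm_nonneg (l n i))])]
            at hb
          rw [integral_const_mul, integral_indicator_const _ measurableSet_Icc, smul_eq_mul,
            mul_one]
          calc _ ≤ ‖l n i‖ * _ := mul_le_mul_of_nonneg_left hb (norm_nonneg _)
            _ = _ := by ring
      _ = 2 * M * C * ∑ i, ‖l n i‖ ^ 2 := by rw [Finset.mul_sum]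
      _ ≤ _ := by gcongr
  have hsq : ∑ i, ∫ e, (‖l n i‖ * (Set.Icc (-(C * ‖l n i‖)) (C * ‖l n i‖)).indicator
        (fun _ => (1 : ℝ)) e) ^ 2 ∂(P.map (ε 0)) ≤ K := by
    refine le_trans (Finset.sum_le_sum fun i _ => ?_) hn
    calc _ ≤ ∫ _, ‖l n i‖ ^ 2 ∂(P.map (ε 0)) := by
          refine integral_mono_of_nonneg (Eventually.of_forall fun e => sq_nonneg _)
            (integrable_const _) (Eventually.of_forall fun e => ?_)
          by_cases he : e ∈ Set.Icc (-(C * ‖l n i‖)) (C * ‖l n i‖) <;> simp [he]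
      _ = _ := by simp
  refine (measure_mono fun ω hω => ?_).trans (h.trans (ENNReal.ofReal_le_ofReal
    (le_trans (by gcongr) hKs)))
  rw [Set.mem_ofPred_eq] at hω ⊢
  exact le_trans (by linarith) (le_abs_self _)

/-- The Knight remainder at a fixed point grows quadratically, in probability. -/
theorem eventually_measure_knightRemainder_lt (hind : iIndepFun ε P)
    (hid : ∀ i, IdentDistrib (ε i) (ε 0) P P)
    (hδ : 0 < δ) (hm : 0 < m) (hM : 0 < M)
    (hdens : ∀ I : Set ℝ, MeasurableSet I → I ⊆ Set.Icc (-δ) δ →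
      m * volume.real I ≤ (P.map (ε 0)).real I ∧ (P.map (ε 0)).real I ≤ M * volume.real I)
    (hmax : ∀ r > 0, ∀ᶠ n in atTop, ∀ i, ‖l n i‖ ≤ r)
    (hK₀ : 0 ≤ K) (hK : ∀ᶠ n in atTop, ∑ i, ‖l n i‖ ^ 2 ≤ K)
    {c : ℝ} (hc : 0 < c) (hlow : ∀ᶠ n in atTop, ∀ u, c * ‖u‖ ^ 2 ≤ ∑ i, l n i u ^ 2)
    {v : E} (hv : 0 < ‖v‖) {η : ℝ} (hη : 0 < η) :
    ∀ᶠ n in atTop, P {ω | ∑ i : Fin n, knightRemainder (ε i ω) (l n i v) < m * c / 8 * ‖v‖ ^ 2}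
      ≤ ENNReal.ofReal η := by
  have : IsProbabilityMeasure (P.map (ε 0)) :=
    Measure.isProbabilityMeasure_map (hid 0).aemeasurable_fst
  -- The minorant has mean at least `2 s`, so falling below `s` is a deviation of at least `s`.
  set s : ℝ := m * c / 8 * ‖v‖ ^ 2 with hs
  have hs0 : 0 < s := by positivity
  -- The second moments are cubic in `l n i v`. The spare factor `‖l n i‖`, eventually at most `η /
  -- (D + 1)`, makes the Chebyshev bound small.
  set D : ℝ := M / 8 * ‖v‖ * (K * ‖v‖ ^ 2) / s ^ 2 with hD
  have hD0 : 0 ≤ D := by positivity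
  filter_upwards [hK, hmax (δ / ‖v‖) (by positivity), hmax (η / (D + 1)) (by positivity), hlow]
    with n hn hn1 hn2 hn3
  have habs : ∀ i, |l n i v| ≤ ‖l n i‖ * ‖v‖ := fun i => (l n i).le_opNorm v
  have hδi : ∀ i, |l n i v| ≤ δ := fun i => (habs i).trans ((le_div_iff₀ hv).1 (hn1 i))
  have hbd : ∀ i, m * (|l n i v| / 2) ≤ (P.map (ε 0)).real (halfway (l n i v)) ∧
      (P.map (ε 0)).real (halfway (l n i v)) ≤ M * (|l n i v| / 2) := fun i => by
    have := hdens _ (measurableSet_halfway (l n i v)) (halfway_subset (hδi i))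
    rwa [volume_halfway] at this
  have h := measure_abs_sum_sub_ge_le hind hid (n := n)
    (h := fun i => (halfway (l n i v)).indicator fun _ => |l n i v| / 2)
    (A := fun i => |l n i v| / 2)
    (fun i => measurable_const.indicator (measurableSet_halfway _))
    (fun i e => by
      rw [abs_of_nonneg (Set.indicator_nonneg (fun _ _ => by positivity) _)]
      exact Set.indicator_le_self' (fun _ _ => by positivity) e) hs0
  have hmean : 2 * s ≤ ∑ i, ∫ e, (halfway (l n i v)).indicator (fun _ => |l n i v| / 2) e
      ∂(P.map (ε 0)) := by
    calc 2 * s = m / 4 * (c * ‖v‖ ^ 2) := by rw [hs]; ring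
      _ ≤ m / 4 * ∑ i, l n i v ^ 2 := by gcongr; exact hn3 v
      _ = ∑ i, m / 4 * l n i v ^ 2 := Finset.mul_sum ..
      _ ≤ _ := by
        refine Finset.sum_le_sum fun i _ => ?_
        rw [integral_indicator_const _ (measurableSet_halfway _), smul_eq_mul, ← sq_abs]
        calc m / 4 * |l n i v| ^ 2 = m * (|l n i v| / 2) * (|l n i v| / 2) := by ring
          _ ≤ _ := by gcongr; exact (hbd i).1
  have hsq : ∑ i, ∫ e, (halfway (l n i v)).indicator (fun _ => |l n i v| / 2) e ^ 2
      ∂(P.map (ε 0)) ≤ M / 8 * (η / (D + 1) * ‖v‖) * (K * ‖v‖ ^ 2) := by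
    calc _ ≤ ∑ i, M / 8 * (η / (D + 1) * ‖v‖) * (‖l n i‖ ^ 2 * ‖v‖ ^ 2) := by
          refine Finset.sum_le_sum fun i _ => ?_
          have : ∀ e, (halfway (l n i v)).indicator (fun _ => |l n i v| / 2) e ^ 2
              = (halfway (l n i v)).indicator (fun _ => (|l n i v| / 2) ^ 2) e := fun e => by
            by_cases he : e ∈ halfway (l n i v) <;> simp [he]
          simp only [this]
          rw [integral_indicator_const _ (measurableSet_halfway _), smul_eq_mul, ← mul_pow]
          calc _ ≤ M * (|l n i v| / 2) * (|l n i v| / 2) ^ 2 := by gcongr; exact (hbd i).2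
            _ = M / 8 * |l n i v| * |l n i v| ^ 2 := by ring
            _ ≤ _ := by
              gcongr
              · exact (habs i).trans (by gcongr; exact hn2 i)
              · exact habs i
      _ = M / 8 * (η / (D + 1) * ‖v‖) * ((∑ i, ‖l n i‖ ^ 2) * ‖v‖ ^ 2) := by
          rw [Finset.sum_mul, Finset.mul_sum]
      _ ≤ _ := by gcongr
  have hfinal : M / 8 * (η / (D + 1) * ‖v‖) * (K * ‖v‖ ^ 2) / s ^ 2 ≤ η := by
    calc _ = D / (D + 1) * η := by rw [hD]; ring
      _ ≤ 1 * η := by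
        gcongr
        rw [div_le_one (by positivity)]; linarith
      _ = η := one_mul η
  refine (measure_mono fun ω hω => ?_).trans (h.trans (ENNReal.ofReal_le_ofReal
    (le_trans (by gcongr) hfinal)))
  rw [Set.mem_ofPred_eq] at hω ⊢
  have hle : ∑ i : Fin n, (halfway (l n i v)).indicator (fun _ => |l n i v| / 2) (ε i ω)
      ≤ ∑ i : Fin n, knightRemainder (ε i ω) (l n i v) :=
    Finset.sum_le_sum fun i _ => indicator_halfway_le_knightRemainder _ _
  exact le_trans (by linarith) (neg_le_abs _)

end LinearPerturbations

/-! ### Linear growth of the quantile process, by convexity and a net argument. -/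

section Growth

variable {E : Type*} [NormedAddCommGroup E] [NormedSpace ℝ E]

/-- By convexity, a lower bound of the quantile process on a sphere extends to its exterior. -/
theorem norm_le_sum_checkFun_of_sphere {τ : ℝ} {n : ℕ} {l : Fin n → E →L[ℝ] ℝ} {e : Fin n → ℝ}
    {C : ℝ} (hC : 0 < C)
    (h : ∀ v, ‖v‖ = C → C ≤ ∑ i, (checkFun τ (e i - l i v) - checkFun τ (e i)))
    {u : E} (hu : C ≤ ‖u‖) : ‖u‖ ≤ ∑ i, (checkFun τ (e i - l i u) - checkFun τ (e i)) := by
  have hu0 : 0 < ‖u‖ := hC.trans_le hu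
  -- `t • u` is where the segment from `0` to `u` meets the sphere; the increment is convex and
  -- vanishes at `0`.
  set t : ℝ := C / ‖u‖ with ht
  have ht0 : 0 < t := by positivity
  have ht1 : t ≤ 1 := (div_le_one hu0).2 hu
  have hv := h (t • u) (by rw [norm_smul, Real.norm_of_nonneg ht0.le, ht]; field_simp)
  have hle : ∑ i, (checkFun τ (e i - l i (t • u)) - checkFun τ (e i))
      ≤ t * ∑ i, (checkFun τ (e i - l i u) - checkFun τ (e i)) := by
    rw [Finset.mul_sum]
    refine Finset.sum_le_sum fun i _ => ?_
    have hconv := (convexOn_checkFun τ).2 (Set.mem_univ (e i)) (Set.mem_univ (e i - l i u))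
      (sub_nonneg.2 ht1) ht0.le (by ring)
    have harg : (1 - t) • e i + t • (e i - l i u) = e i - l i (t • u) := by
      simp only [smul_eq_mul, map_smul]; ring
    rw [harg] at hconv
    simp only [smul_eq_mul] at hconv
    linarith
  have hCt : C = t * ‖u‖ := by rw [ht]; field_simp
  exact le_of_mul_le_mul_left (by linarith) ht0

variable {Ω : Type*} [MeasurableSpace Ω] {P : Measure Ω} [IsProbabilityMeasure P] {ε : ℕ → Ω → ℝ}
  {l : (n : ℕ) → Fin n → E →L[ℝ] ℝ} {K : ℝ} {δ m M : ℝ}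

/-- Outside a large ball, the normalized quantile process grows at least linearly, with probability
close to one. -/
theorem exists_radius_growth [FiniteDimensional ℝ E] (hind : iIndepFun ε P)
    (hid : ∀ i, IdentDistrib (ε i) (ε 0) P P) {τ : ℝ} (hτ₀ : 0 < τ) (hτ₁ : τ < 1)
    (hmean : ∫ e, checkScore τ e ∂(P.map (ε 0)) = 0)
    (hδ : 0 < δ) (hm : 0 < m) (hM : 0 < M)
    (hdens : ∀ I : Set ℝ, MeasurableSet I → I ⊆ Set.Icc (-δ) δ →
      m * volume.real I ≤ (P.map (ε 0)).real I ∧ (P.map (ε 0)).real I ≤ M * volume.real I)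
    (hmax : ∀ r > 0, ∀ᶠ n in atTop, ∀ i, ‖l n i‖ ≤ r)
    (hK₀ : 0 ≤ K) (hK : ∀ᶠ n in atTop, ∑ i, ‖l n i‖ ^ 2 ≤ K)
    {c : ℝ} (hc : 0 < c) (hlow : ∀ᶠ n in atTop, ∀ u, c * ‖u‖ ^ 2 ≤ ∑ i, l n i u ^ 2)
    {η : ℝ} (hη : 0 < η) :
    ∃ C > 0, ∀ᶠ n in atTop,
      P {ω | ∃ u, C ≤ ‖u‖ ∧
        ∑ i : Fin n, (checkFun τ (ε i ω - l n i u) - checkFun τ (ε i ω)) < ‖u‖}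
      ≤ ENNReal.ofReal η := by
  have hη3 : 0 < η / 3 := by positivity
  obtain ⟨R, hR, hscore⟩ := exists_bound_score hind hid hτ₀ hτ₁ hmean hK₀ hK hη3
  set κ : ℝ := m * c / 8 with hκ
  have hκ0 : 0 < κ := by positivity
  -- Chosen so that `κ C²` covers the score `R C`, the target `C` and a discretization error `1`.
  set C : ℝ := (R + 2) / κ + 1 with hCdef
  have hC1 : 1 ≤ C := by rw [hCdef]; linarith [show 0 < (R + 2) / κ by positivity]
  have hC : 0 < C := by linarith
  have hCκ : R * C + C + 1 ≤ κ * C ^ 2 := by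
    have h1 : κ * C = R + 2 + κ := by rw [hCdef]; field_simp
    calc R * C + C + 1 ≤ (R + 2 + κ) * C := by nlinarith
      _ = κ * C ^ 2 := by rw [← h1]; ring
  obtain ⟨L, hL, hlip⟩ := exists_bound_lipschitz hind hid hδ hM
    (fun I hI hI' => (hdens I hI hI').2) hmax hK₀ hK hC hη3
  -- Mesh `1 / L` costs at most `1` in the remainder. The net does not depend on `n`, so a finite
  -- union bound applies.
  obtain ⟨t, hts, htfin, hcover⟩ := (isCompact_sphere (0 : E) C).finite_cover_balls
    (show 0 < 1 / L by positivity)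
  lift t to Finset E using htfin
  have hnet : ∀ᶠ n in atTop, ∀ v ∈ t,
      P {ω | ∑ i : Fin n, knightRemainder (ε i ω) (l n i v) < κ * ‖v‖ ^ 2}
        -- The `+ 1` allows for an empty net.
        ≤ ENNReal.ofReal (η / 3 / (t.card + 1)) := by
    refine (Filter.eventually_all_finset t).2 fun v hv => ?_
    refine eventually_measure_knightRemainder_lt hind hid hδ hm hM hdens hmax hK₀ hK hc hlow ?_
      (by positivity)
    have : ‖v‖ = C := by simpa using hts hv
    rw [this]; exact hC
  refine ⟨C, hC, ?_⟩
  filter_upwards [hscore, hlip, hnet] with n h1 h2 h3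
  set A₁ := {ω | R < ‖∑ i : Fin n, checkScore τ (ε i ω) • l n i‖}
  set A₂ := {ω | L ≤ ∑ i : Fin n, ‖l n i‖ *
    (Set.Icc (-(C * ‖l n i‖)) (C * ‖l n i‖)).indicator (fun _ => (1 : ℝ)) (ε i ω)}
  set A₃ := ⋃ v ∈ t, {ω | ∑ i : Fin n, knightRemainder (ε i ω) (l n i v) < κ * ‖v‖ ^ 2}
  have hA₃ : P A₃ ≤ ENNReal.ofReal (η / 3) := by
    calc P A₃ ≤ ∑ v ∈ t, ENNReal.ofReal (η / 3 / (t.card + 1)) :=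
          (measure_biUnion_finset_le _ _).trans (Finset.sum_le_sum h3)
      _ = ENNReal.ofReal (t.card * (η / 3 / (t.card + 1))) := by
          rw [Finset.sum_const, nsmul_eq_mul, ENNReal.ofReal_mul (by positivity)]; simp
      _ ≤ _ := by
          refine ENNReal.ofReal_le_ofReal ?_
          rw [mul_div_assoc', div_le_iff₀ (by positivity)]
          nlinarith
  have hsub : {ω | ∃ u, C ≤ ‖u‖ ∧
      ∑ i : Fin n, (checkFun τ (ε i ω - l n i u) - checkFun τ (ε i ω)) < ‖u‖}
      ⊆ A₁ ∪ A₂ ∪ A₃ := by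
    rintro ω ⟨u, hu, hlt⟩
    by_contra hcon
    simp only [Set.mem_union, not_or] at hcon
    obtain ⟨⟨g1, g2⟩, g3⟩ := hcon
    simp only [A₁, Set.mem_ofPred_eq, not_lt] at g1
    simp only [A₂, Set.mem_ofPred_eq, not_le] at g2
    simp only [A₃, Set.mem_iUnion, Set.mem_ofPred_eq, not_exists, not_lt] at g3
    refine absurd hlt (not_lt.2 (norm_le_sum_checkFun_of_sphere hC (fun w hw => ?_) hu))
    obtain ⟨v, hv, hwv⟩ : ∃ v ∈ t, ‖w - v‖ < 1 / L := by
      have := hcover (show w ∈ Metric.sphere (0 : E) C by simpa using hw)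
      simpa [dist_eq_norm] using this
    have hvC : ‖v‖ = C := by simpa using hts hv
    have hB : ∑ i : Fin n, (knightRemainder (ε i ω) (l n i v) - knightRemainder (ε i ω) (l n i w))
        ≤ 1 := by
      calc _ ≤ ∑ i : Fin n, ‖w - v‖ * (‖l n i‖ *
            (Set.Icc (-(C * ‖l n i‖)) (C * ‖l n i‖)).indicator (fun _ => (1 : ℝ)) (ε i ω)) := by
            refine Finset.sum_le_sum fun i _ => ?_
            have hb : ∀ x : E, ‖x‖ = C → |l n i x| ≤ C * ‖l n i‖ := fun x hx => by
              have := (l n i).le_opNorm x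
              rwa [hx, mul_comm] at this
            refine (knightRemainder_sub_le (hb v hvC) (hb w hw)).trans ?_
            rw [← mul_assoc]
            refine mul_le_mul_of_nonneg_right ?_ (Set.indicator_nonneg (fun _ _ => zero_le_one) _)
            rw [← map_sub, norm_sub_rev, mul_comm]
            exact (l n i).le_opNorm _
        _ ≤ 1 / L * L := by
            rw [← Finset.mul_sum]
            gcongr
            exact Finset.sum_nonneg fun i _ => mul_nonneg (norm_nonneg _)
              (Set.indicator_nonneg (fun _ _ => zero_le_one) _)
        _ = 1 := by field_simp
    have hW : ∑ i : Fin n, checkScore τ (ε i ω) * l n i w ≤ R * C := by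
      have := (le_abs_self _).trans
        ((∑ i : Fin n, checkScore τ (ε i ω) • l n i).le_of_opNorm_le g1 w)
      rw [hw] at this
      simpa using this
    have hv' := g3 v hv
    rw [hvC] at hv'
    simp only [checkFun_sub_eq, Finset.sum_sub_distrib] at hB ⊢
    linarith
  calc _ ≤ P (A₁ ∪ A₂ ∪ A₃) := measure_mono hsub
    _ ≤ P A₁ + P A₂ + P A₃ := (measure_union_le _ _).trans (by gcongr; exact measure_union_le _ _)
    _ ≤ ENNReal.ofReal (η / 3) + ENNReal.ofReal (η / 3) + ENNReal.ofReal (η / 3) := by gcongr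
    _ = ENNReal.ofReal η := by
      rw [← ENNReal.ofReal_add hη3.le hη3.le, ← ENNReal.ofReal_add (by positivity) hη3.le]
      ring_nf

end Growth

/-! ### Consequences of the design assumption. -/

section Design

variable {p : ℕ} {d : Fin p → ℕ}

/-- The linear predictor as a continuous linear functional of the parameter. -/
noncomputable def linPredCLM (x : GroupedVec d) : GroupedVec d →L[ℝ] ℝ :=
  ∑ j, (innerSL ℝ (x j)).comp (ContinuousLinearMap.proj j)

theorem linPredCLM_apply (x b : GroupedVec d) : linPredCLM x b = linPred x b := by
  simp [linPredCLM, linPred]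

theorem linPred_sub (x b b' : GroupedVec d) : linPred x (b - b') = linPred x b - linPred x b' := by
  simp only [← linPredCLM_apply, map_sub]

theorem linPred_self (x : GroupedVec d) : linPred x x = ∑ j, ‖x j‖ ^ 2 := by
  simp [linPred]

theorem linPred_eq_sum_coord (x b : GroupedVec d) :
    linPred x b = ∑ a : Σ j, Fin (d j), x a.1 a.2 * b a.1 a.2 := by
  simp [linPred, Fintype.sum_sigma, PiLp.inner_apply, mul_comm]

/-- The norm on `GroupedVec d` is the maximum of the group norms, so the dual norm is at most their
sum; Cauchy–Schwarz costs the factor `p`. -/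
theorem norm_linPredCLM_sq_le (x : GroupedVec d) : ‖linPredCLM x‖ ^ 2 ≤ p * linPred x x := by
  have h : ‖linPredCLM x‖ ≤ ∑ j, ‖x j‖ := by
    refine ContinuousLinearMap.opNorm_le_bound _ (Finset.sum_nonneg fun j _ => norm_nonneg _)
      fun b => ?_
    rw [linPredCLM_apply, linPred, Finset.sum_mul]
    refine (norm_sum_le _ _).trans (Finset.sum_le_sum fun j _ => ?_)
    exact (norm_inner_le_norm _ _).trans (by gcongr; exact norm_le_pi_norm b j)
  calc ‖linPredCLM x‖ ^ 2 ≤ (∑ j, ‖x j‖) ^ 2 := by gcongr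
    _ ≤ (Finset.univ : Finset (Fin p)).card * ∑ j, ‖x j‖ ^ 2 := sq_sum_le_card_mul_sum_sq
    _ = p * linPred x x := by rw [linPred_self]; simp

theorem sum_linPred_self_eq_trace {n : ℕ} (hn : 0 < n) (x : Fin n → GroupedVec d) :
    ∑ i, linPred (x i) (x i) = n * (designGram x).trace := by
  have : (n : ℝ) ≠ 0 := by positivity
  simp only [Matrix.trace, Matrix.diag_apply, designGram, Matrix.of_apply, linPred_eq_sum_coord]
  rw [← Finset.mul_sum, mul_inv_cancel_left₀ this, Finset.sum_comm]

theorem inv_mul_sum_linPred_sq {n : ℕ} (x : Fin n → GroupedVec d) (u : GroupedVec d) :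
    (n : ℝ)⁻¹ * ∑ i, linPred (x i) u ^ 2
      = (fun a : Σ j, Fin (d j) => u a.1 a.2) ⬝ᵥ
        (designGram x).mulVec fun a : Σ j, Fin (d j) => u a.1 a.2 := by
  simp only [dotProduct, Matrix.mulVec, designGram, Matrix.of_apply, linPred_eq_sum_coord, sq,
    Finset.mul_sum, Finset.sum_mul]
  rw [Finset.sum_comm]
  refine Finset.sum_congr rfl fun a _ => ?_
  rw [Finset.sum_comm]
  exact Finset.sum_congr rfl fun b _ => Finset.sum_congr rfl fun i _ => by ring

/-- The linear predictor of the rescaled parameter `√n (β - β⁰)`. -/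
noncomputable def scaledPred (X : (n : ℕ) → Fin n → GroupedVec d) (n : ℕ) (i : Fin n) :
    GroupedVec d →L[ℝ] ℝ :=
  (√(n : ℝ))⁻¹ • linPredCLM (X n i)

variable {X : (n : ℕ) → Fin n → GroupedVec d} {U : Matrix (Σ j, Fin (d j)) (Σ j, Fin (d j)) ℝ}

theorem norm_scaledPred_sq_le (n : ℕ) (i : Fin n) :
    ‖scaledPred X n i‖ ^ 2 ≤ p * ((n : ℝ)⁻¹ * linPred (X n i) (X n i)) := by
  rw [scaledPred, norm_smul, mul_pow, norm_inv, inv_pow, Real.norm_of_nonneg (Real.sqrt_nonneg _),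
    Real.sq_sqrt (Nat.cast_nonneg n)]
  calc _ ≤ (n : ℝ)⁻¹ * (p * linPred (X n i) (X n i)) := by
        gcongr; exact norm_linPredCLM_sq_le _
    _ = _ := by ring

theorem DesignAssumption.eventually_sum_linPred_self_le (hX : DesignAssumption X U) :
    ∀ᶠ n : ℕ in atTop, ∑ i, linPred (X n i) (X n i) ≤ n * (|U.trace| + 1) := by
  have h : Tendsto (fun n => (designGram (X n)).trace) atTop (𝓝 U.trace) :=
    (Continuous.matrix_trace continuous_id).continuousAt.tendsto.comp hX.gram_tendsto
  filter_upwards [h.eventually (gt_mem_nhds (show U.trace < |U.trace| + 1 by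
    linarith [le_abs_self U.trace])), eventually_gt_atTop 0] with n hn hn0
  rw [sum_linPred_self_eq_trace hn0]
  gcongr

theorem DesignAssumption.eventually_norm_scaledPred_le (hX : DesignAssumption X U) {r : ℝ}
    (hr : 0 < r) : ∀ᶠ n in atTop, ∀ i, ‖scaledPred X n i‖ ≤ r := by
  have h := hX.max_tendsto.const_mul (p : ℝ)
  rw [mul_zero] at h
  filter_upwards [h.eventually (gt_mem_nhds (show 0 < r ^ 2 by positivity))] with n hn i
  refine le_of_sq_le_sq ((norm_scaledPred_sq_le n i).trans (le_trans ?_ hn.le)) hr.le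
  gcongr
  exact le_ciSup (f := fun i => linPred (X n i) (X n i)) (Set.finite_range _).bddAbove i

theorem DesignAssumption.eventually_sum_norm_scaledPred_sq_le (hX : DesignAssumption X U) :
    ∀ᶠ n in atTop, ∑ i, ‖scaledPred X n i‖ ^ 2 ≤ p * (|U.trace| + 1) := by
  filter_upwards [hX.eventually_sum_linPred_self_le, eventually_gt_atTop 0] with n hn hn0
  have hn0' : (0 : ℝ) < n := by exact_mod_cast hn0
  calc _ ≤ ∑ i, p * ((n : ℝ)⁻¹ * linPred (X n i) (X n i)) :=
        Finset.sum_le_sum fun i _ => norm_scaledPred_sq_le n i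
    _ = p * ((n : ℝ)⁻¹ * ∑ i, linPred (X n i) (X n i)) := by simp only [Finset.mul_sum]
    _ ≤ p * ((n : ℝ)⁻¹ * (n * (|U.trace| + 1))) := by gcongr
    _ = _ := by rw [inv_mul_cancel_left₀ hn0'.ne']

/-- The form of `U` has a positive lower bound on the compact unit sphere. Gram matrices near `U`
keep half of it uniformly there, and homogeneity does the rest. -/
theorem DesignAssumption.exists_sq_le_sum (hX : DesignAssumption X U) :
    ∃ c > 0, ∀ᶠ n in atTop, ∀ u, c * ‖u‖ ^ 2 ≤ ∑ i, scaledPred X n i u ^ 2 := by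
  let w : GroupedVec d → (Σ j, Fin (d j)) → ℝ := fun u a => u a.1 a.2
  have hw : Continuous w := by
    refine continuous_pi fun a => ?_
    exact (EuclideanSpace.proj (𝕜 := ℝ) a.2).continuous.comp (continuous_apply a.1)
  have hq : Continuous fun z : Matrix (Σ j, Fin (d j)) (Σ j, Fin (d j)) ℝ × GroupedVec d =>
      w z.2 ⬝ᵥ z.1.mulVec (w z.2) :=
    Continuous.dotProduct (hw.comp continuous_snd)
      (Continuous.matrix_mulVec continuous_fst (hw.comp continuous_snd))
  have hS := isCompact_sphere (0 : GroupedVec d) 1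
  obtain ⟨c, hc, hcS⟩ := hS.exists_forall_le' (f := fun u => w u ⬝ᵥ U.mulVec (w u)) (a := 0)
    (hq.comp (Continuous.prodMk_right U)).continuousOn fun u hu => by
      have hne : w u ≠ 0 := fun h0 => by
        have : u = 0 := by
          ext j k
          exact congrFun h0 ⟨j, k⟩
        simp [this] at hu
      simpa using hX.posDef.dotProduct_mulVec_pos hne
  have hev : ∀ᶠ G in 𝓝 U, ∀ u ∈ Metric.sphere (0 : GroupedVec d) 1,
      c / 2 < w u ⬝ᵥ G.mulVec (w u) := by
    refine hS.eventually_forall_of_forall_eventually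
      (P := fun (G : Matrix (Σ j, Fin (d j)) (Σ j, Fin (d j)) ℝ) u => c / 2 < w u ⬝ᵥ G.mulVec (w u)) fun u hu => ?_
    exact hq.continuousAt.eventually (lt_mem_nhds (by linarith [hcS u hu]))
  refine ⟨c / 2, by positivity, ?_⟩
  filter_upwards [hX.gram_tendsto.eventually hev] with n hn u
  have hscale : ∀ u, ∑ i, scaledPred X n i u ^ 2 = w u ⬝ᵥ (designGram (X n)).mulVec (w u) := by
    intro u
    rw [← inv_mul_sum_linPred_sq, Finset.mul_sum]
    refine Finset.sum_congr rfl fun i _ => ?_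
    simp only [scaledPred, FunLike.coe_smul, Pi.smul_apply, linPredCLM_apply, smul_eq_mul]
    rw [mul_pow, inv_pow, Real.sq_sqrt (Nat.cast_nonneg n)]
  rcases eq_or_ne u 0 with rfl | hu
  · simp
  have hu0 : 0 < ‖u‖ := norm_pos_iff.2 hu
  have h := hn (‖u‖⁻¹ • u) (by simp [norm_smul, hu0.ne'])
  rw [← hscale] at h
  simp only [map_smul, smul_eq_mul, mul_pow, ← Finset.mul_sum] at h
  rw [inv_pow, inv_mul_eq_div, lt_div_iff₀ (by positivity)] at h
  exact h.le

end Design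

/-! ### Deterministic selection on the growth event. -/

section Selection

variable {p : ℕ} {d : Fin p → ℕ} {n : ℕ} {τ : ℝ}

theorem quantileProcess_nonneg (hτ₀ : 0 < τ) (hτ₁ : τ < 1) (x : Fin n → GroupedVec d)
    (Y : Fin n → ℝ) (b : GroupedVec d) : 0 ≤ quantileProcess τ x Y b :=
  Finset.sum_nonneg fun _ _ => checkFun_nonneg hτ₀ hτ₁ _

/-- The change of variable `u = √n (β - β⁰)`, linking the estimators to the growth bound. -/
theorem quantileProcess_response_sub {Ω : Type*} (hn : 0 < n)
    (X : (n : ℕ) → Fin n → GroupedVec d) (b₀ b : GroupedVec d) (ε : ℕ → Ω → ℝ) (ω : Ω) :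
    quantileProcess τ (X n) (response (X n) b₀ ε ω) b
        - quantileProcess τ (X n) (response (X n) b₀ ε ω) b₀
      = ∑ i : Fin n, (checkFun τ (ε i ω - scaledPred X n i (√(n : ℝ) • (b - b₀)))
          - checkFun τ (ε i ω)) := by
  have hs : √(n : ℝ) ≠ 0 := by positivity
  rw [quantileProcess, quantileProcess, ← Finset.sum_sub_distrib]
  refine Finset.sum_congr rfl fun i _ => ?_
  have : scaledPred X n i (√(n : ℝ) • (b - b₀)) = linPred (X n i) b - linPred (X n i) b₀ := by
    simp only [scaledPred, FunLike.coe_smul, Pi.smul_apply, linPredCLM_apply,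
      map_smul, smul_eq_mul, linPred_sub]
    field_simp
  rw [this, response]
  congr 2 <;> ring

/-- Deleting one group changes the quantile process by at most a multiple of its norm. -/
theorem quantileProcess_update_zero_le (hτ₀ : 0 < τ) (hτ₁ : τ < 1) (x : Fin n → GroupedVec d)
    (Y : Fin n → ℝ) (b : GroupedVec d) (j : Fin p) :
    quantileProcess τ x Y (Function.update b j 0)
      ≤ quantileProcess τ x Y b + (∑ i, ‖x i j‖) * ‖b j‖ := by
  rw [← sub_le_iff_le_add', quantileProcess, quantileProcess, ← Finset.sum_sub_distrib,
    Finset.sum_mul]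
  refine Finset.sum_le_sum fun i _ => (checkFun_sub_le hτ₀ hτ₁ _ _).trans ?_
  have h : b - Function.update b j 0 = Pi.single j (b j) := by
    ext k : 1
    rcases eq_or_ne k j with rfl | hk
    · simp
    · simp [hk]
  have h' : linPred (x i) (Pi.single j (b j)) = inner ℝ (x i j) (b j) := by
    rw [linPred, Finset.sum_eq_single j]
    · simp
    · intro k _ hk; simp [hk]
    · simp
  rw [sub_sub_sub_cancel_left, ← linPred_sub, h, h']
  exact abs_real_inner_le_norm _ _

/-- A group whose weight exceeds the Lipschitz constant of the quantile process is deleted. -/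
theorem IsAdaptiveGroupLassoEstimate.eq_zero_of_lt (hτ₀ : 0 < τ) (hτ₁ : τ < 1) {γ μ : ℝ}
    {x : Fin n → GroupedVec d} {Y : Fin n → ℝ} {bt b : GroupedVec d}
    (hb : IsAdaptiveGroupLassoEstimate τ γ μ x Y bt b)
    (hfin : penalizedProcess τ γ μ x Y bt b ≠ ⊤) {j : Fin p} {w : ℝ} (hw : 0 ≤ w) (hμ : 0 ≤ μ)
    (hwj : ENNReal.ofReal w ≤ adaptiveWeight γ bt j) (hlt : ∑ i, ‖x i j‖ < μ * w) : b j = 0 := by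
  by_contra hne
  have hpos : 0 < ‖b j‖ := norm_pos_iff.2 hne
  have hle := hb (Set.mem_univ (Function.update b j 0))
  simp only [Set.mem_ofPred_eq, penalizedProcess] at hle hfin
  set R : ENNReal := ∑ k ∈ Finset.univ.erase j, adaptiveWeight γ bt k * ‖b k‖ₑ
  have h1 : ∑ k, adaptiveWeight γ bt k * ‖b k‖ₑ = adaptiveWeight γ bt j * ‖b j‖ₑ + R :=
    (Finset.add_sum_erase _ _ (Finset.mem_univ j)).symm
  have h2 : ∑ k, adaptiveWeight γ bt k * ‖Function.update b j 0 k‖ₑ = R := by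
    rw [← Finset.add_sum_erase _ _ (Finset.mem_univ j)]
    simp only [Function.update_self, enorm_zero, mul_zero, zero_add]
    refine Finset.sum_congr rfl fun k hk => ?_
    rw [Function.update_of_ne (Finset.ne_of_mem_erase hk)]
  rw [h1] at hle hfin
  rw [h2, mul_add, ← add_assoc] at hle
  rw [mul_add, ← add_assoc] at hfin
  -- Finiteness of the other groups' penalty permits cancelling it in `[0, ∞]`.
  have hR := (ENNReal.add_ne_top.1 hfin).2
  have h3 := (ENNReal.add_le_add_iff_right hR).1 hle
  have hq := quantileProcess_nonneg hτ₀ hτ₁ x Y b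
  have hL : 0 ≤ ∑ i, ‖x i j‖ := Finset.sum_nonneg fun i _ => norm_nonneg _
  -- The weight may be infinite; its finite minorant `w` brings the comparison back to the reals.
  have h4 : ENNReal.ofReal (quantileProcess τ x Y b + μ * (w * ‖b j‖))
      ≤ ENNReal.ofReal (quantileProcess τ x Y b + (∑ i, ‖x i j‖) * ‖b j‖) := by
    calc _ = ENNReal.ofReal (quantileProcess τ x Y b)
          + ENNReal.ofReal μ * (ENNReal.ofReal w * ‖b j‖ₑ) := by
          rw [ENNReal.ofReal_add hq (mul_nonneg hμ (mul_nonneg hw hpos.le)),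
            ENNReal.ofReal_mul hμ, ENNReal.ofReal_mul hw, ofReal_norm]
      _ ≤ ENNReal.ofReal (quantileProcess τ x Y b)
          + ENNReal.ofReal μ * (adaptiveWeight γ bt j * ‖b j‖ₑ) := by gcongr
      _ ≤ ENNReal.ofReal (quantileProcess τ x Y (Function.update b j 0)) := h3
      _ ≤ _ := ENNReal.ofReal_le_ofReal (quantileProcess_update_zero_le hτ₀ hτ₁ x Y b j)
  rw [ENNReal.ofReal_le_ofReal_iff (add_nonneg hq (mul_nonneg hL hpos.le))] at h4
  have h5 : (∑ i, ‖x i j‖) * ‖b j‖ < μ * w * ‖b j‖ := mul_lt_mul_of_pos_right hlt hpos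
  linarith

/-- The penalty at `b` when the pilot estimate is bounded away from `0` on the support of `b`. -/
theorem penalizedProcess_le {γ μ a : ℝ} (hγ : 0 < γ) (ha : 0 < a) (hμ : 0 ≤ μ)
    {x : Fin n → GroupedVec d} {Y : Fin n → ℝ} {bt b : GroupedVec d} (hτ₀ : 0 < τ) (hτ₁ : τ < 1)
    (h : ∀ j, b j ≠ 0 → a ≤ ‖bt j‖) :
    penalizedProcess τ γ μ x Y bt b
      ≤ ENNReal.ofReal (quantileProcess τ x Y b + μ * (a ^ (-γ) * ∑ j, ‖b j‖)) := by
  have hsum : 0 ≤ ∑ j, ‖b j‖ := Finset.sum_nonneg fun j _ => norm_nonneg _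
  rw [ENNReal.ofReal_add (quantileProcess_nonneg hτ₀ hτ₁ x Y b) (by positivity),
    ENNReal.ofReal_mul hμ, Finset.mul_sum,
    ENNReal.ofReal_sum_of_nonneg fun j _ => by positivity, penalizedProcess]
  gcongr with j
  rcases eq_or_ne (b j) 0 with hj | hj
  · simp [hj]
  · rw [ENNReal.ofReal_mul (by positivity), ofReal_norm, ← ENNReal.ofReal_rpow_of_pos ha,
      adaptiveWeight, ENNReal.rpow_neg, ENNReal.rpow_neg, ← ofReal_norm (bt j)]
    gcongr
    exact h j hj

/-- Negative powers are decreasing; in `ENNReal` this includes the infinite weight of a vanishing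
pilot group. -/
theorem le_adaptiveWeight {γ a : ℝ} (hγ : 0 < γ) (ha : 0 < a) {bt : GroupedVec d} {j : Fin p}
    (h : ‖bt j‖ ≤ a) : ENNReal.ofReal (a ^ (-γ)) ≤ adaptiveWeight γ bt j := by
  rw [← ENNReal.ofReal_rpow_of_pos ha, adaptiveWeight, ENNReal.rpow_neg, ENNReal.rpow_neg,
    ENNReal.inv_le_inv, ← ofReal_norm]
  exact ENNReal.rpow_le_rpow (ENNReal.ofReal_le_ofReal h) hγ.le

/-- Exact selection, on the event where the quantile process grows linearly away from the true
parameter. -/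
theorem activeGroups_eq_of_growth {Ω : Type*} (hτ₀ : 0 < τ) (hτ₁ : τ < 1) {γ : ℝ} (hγ : 0 < γ)
    {X : (n : ℕ) → Fin n → GroupedVec d} {b₀ : GroupedVec d} {ε : ℕ → Ω → ℝ} {ω : Ω} {μ C a : ℝ}
    {bt b : GroupedVec d} (hn : 0 < n) (hμ : 0 ≤ μ) (hC : 0 < C)
    (hgrowth : ∀ u, C ≤ ‖u‖ →
      ‖u‖ ≤ ∑ i : Fin n, (checkFun τ (ε i ω - scaledPred X n i u) - checkFun τ (ε i ω)))
    (hbt : IsQuantileEstimate τ (X n) (response (X n) b₀ ε ω) bt)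
    (hb : IsAdaptiveGroupLassoEstimate τ γ μ (X n) (response (X n) b₀ ε ω) bt b)
    (ha : 0 < a) (hab₀ : ∀ j, b₀ j ≠ 0 → 2 * a ≤ ‖b₀ j‖) (hCa : C / √(n : ℝ) < a)
    (hμa : μ / √(n : ℝ) * (a ^ (-γ) * ∑ j, ‖b₀ j‖) < a)
    (hsparse : ∀ j, ∑ i, ‖X n i j‖ < μ * (C / √(n : ℝ)) ^ (-γ)) :
    activeGroups b = activeGroups b₀ := by
  have hs : 0 < √(n : ℝ) := by positivity
  have hnorm : ∀ c : GroupedVec d, ‖√(n : ℝ) • (c - b₀)‖ = √(n : ℝ) * ‖c - b₀‖ := fun c => by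
    rw [norm_smul, Real.norm_of_nonneg hs.le]
  -- At a minimizer the increment from `b₀` is nonpositive, which growth forbids outside the ball.
  have hbt' : ‖bt - b₀‖ ≤ C / √(n : ℝ) := by
    rw [le_div_iff₀' hs, ← hnorm]
    by_contra! hcon
    have h1 := hgrowth _ hcon.le
    rw [← quantileProcess_response_sub hn] at h1
    have h2 : quantileProcess τ (X n) (response (X n) b₀ ε ω) bt
      ≤ quantileProcess τ (X n) (response (X n) b₀ ε ω) b₀ := hbt (Set.mem_univ b₀)
    linarith
  have hcoord : ∀ (c : GroupedVec d) j, ‖c j - b₀ j‖ ≤ ‖c - b₀‖ := fun c j =>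
    norm_le_pi_norm (c - b₀) j
  set H : ℝ := a ^ (-γ) * ∑ j, ‖b₀ j‖ with hH
  have hpen := penalizedProcess_le (x := X n) (Y := response (X n) b₀ ε ω) (bt := bt) hγ ha hμ
    hτ₀ hτ₁ (fun j hj => by
      have h1 := hab₀ j hj
      have h2 := hcoord bt j
      have h3 := norm_sub_norm_le (b₀ j) (bt j)
      rw [norm_sub_rev] at h3
      linarith)
  have hle : penalizedProcess τ γ μ (X n) (response (X n) b₀ ε ω) bt b
      ≤ penalizedProcess τ γ μ (X n) (response (X n) b₀ ε ω) bt b₀ := hb (Set.mem_univ b₀)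
  have hfin : penalizedProcess τ γ μ (X n) (response (X n) b₀ ε ω) bt b ≠ ⊤ :=
    ne_top_of_le_ne_top ENNReal.ofReal_ne_top (hle.trans hpen)
  have hH0 : 0 ≤ H := mul_nonneg (by positivity) (Finset.sum_nonneg fun j _ => norm_nonneg _)
  have hq : quantileProcess τ (X n) (response (X n) b₀ ε ω) b
      ≤ quantileProcess τ (X n) (response (X n) b₀ ε ω) b₀ + μ * H := by
    rw [← ENNReal.ofReal_le_ofReal_iff
      (add_nonneg (quantileProcess_nonneg hτ₀ hτ₁ _ _ _) (mul_nonneg hμ hH0))]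
    exact le_trans le_self_add (hle.trans hpen)
  -- Either the growth bound applies and yields `√n ‖b - b₀‖ ≤ μ H`, or `b` is already within `C /
  -- √n`.
  have hba : ‖b - b₀‖ < a := by
    by_cases hCu : C ≤ ‖√(n : ℝ) • (b - b₀)‖
    · have h1 := hgrowth _ hCu
      rw [← quantileProcess_response_sub hn, hnorm] at h1
      have h2 : ‖b - b₀‖ ≤ μ * H / √(n : ℝ) := by
        rw [le_div_iff₀' hs]; linarith
      rw [mul_div_right_comm] at h2
      exact h2.trans_lt hμa
    · rw [not_le, hnorm, ← lt_div_iff₀' hs] at hCu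
      exact hCu.trans hCa
  ext j
  simp only [activeGroups, Set.mem_ofPred_eq, ne_eq, norm_eq_zero, not_iff_not]
  constructor
  · intro hj
    by_contra hne
    have h1 := hcoord b j
    rw [hj, zero_sub, norm_neg] at h1
    linarith [hab₀ j hne]
  · intro hj
    refine hb.eq_zero_of_lt hτ₀ hτ₁ hfin (by positivity) hμ
      (le_adaptiveWeight hγ (by positivity) ?_) (hsparse j)
    have h1 := hcoord bt j
    rw [hj, sub_zero] at h1
    exact h1.trans hbt'

/-- The sparsity condition on the tuning parameters makes the weights of the inactive groups
dominate the crude Lipschitz constant of the quantile process. -/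
theorem DesignAssumption.eventually_sum_norm_lt {X : (n : ℕ) → Fin n → GroupedVec d}
    {U : Matrix (Σ j, Fin (d j)) (Σ j, Fin (d j)) ℝ} (hX : DesignAssumption X U) {γ : ℝ}
    {μ : ℕ → ℝ} (hμ : Tendsto (fun n : ℕ => (n : ℝ) ^ (γ / 2 - 1) * μ n) atTop atTop)
    {C : ℝ} (hC : 0 < C) :
    ∀ᶠ n in atTop, ∀ j, ∑ i, ‖X n i j‖ < μ n * (C / √(n : ℝ)) ^ (-γ) := by
  set K : ℝ := |U.trace| + 1 with hK
  have hK0 : 0 < K := by positivity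
  filter_upwards [hX.eventually_sum_linPred_self_le, eventually_gt_atTop 0,
    hμ.eventually_gt_atTop (√K * C ^ γ)] with n h1 hn h2 j
  have hn0 : (0 : ℝ) < n := by exact_mod_cast hn
  have hle : ∑ i, ‖X n i j‖ ≤ n * √K := by
    have hsqrt : √(n ^ 2 * K) = n * √K := by
      rw [Real.sqrt_mul (by positivity), Real.sqrt_sq hn0.le]
    rw [← hsqrt]
    refine Real.le_sqrt_of_sq_le ?_
    calc (∑ i, ‖X n i j‖) ^ 2
        ≤ (Finset.univ : Finset (Fin n)).card * ∑ i, ‖X n i j‖ ^ 2 := sq_sum_le_card_mul_sum_sq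
      _ = n * ∑ i, ‖X n i j‖ ^ 2 := by simp
      _ ≤ n * ∑ i, linPred (X n i) (X n i) := by
          gcongr with i
          rw [linPred_self]
          exact Finset.single_le_sum (f := fun j => ‖X n i j‖ ^ 2) (fun k _ => sq_nonneg _)
            (Finset.mem_univ j)
      _ ≤ n * (n * K) := by gcongr
      _ = n ^ 2 * K := by ring
  -- The extracted factor `n` matches the Lipschitz constant, of order `n` by Cauchy–Schwarz.
  have hpow : (C / √(n : ℝ)) ^ (-γ) = (C ^ γ)⁻¹ * (n * (n : ℝ) ^ (γ / 2 - 1)) := by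
    rw [Real.rpow_neg (by positivity), Real.div_rpow hC.le (Real.sqrt_nonneg _), inv_div,
      Real.sqrt_eq_rpow, ← Real.rpow_mul hn0.le, Real.rpow_sub_one hn0.ne']
    field_simp
  have hCγ : 0 < C ^ γ := by positivity
  calc _ ≤ n * √K := hle
    _ = n * (C ^ γ)⁻¹ * (√K * C ^ γ) := by field_simp
    _ < n * (C ^ γ)⁻¹ * ((n : ℝ) ^ (γ / 2 - 1) * μ n) := by gcongr
    _ = _ := by rw [hpow]; ring

/-- The factor `2` lets an active pilot group move by `a` and keep norm at least `a`. -/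
theorem exists_pos_le_norm_of_ne_zero (b : GroupedVec d) :
    ∃ a > 0, ∀ j, b j ≠ 0 → 2 * a ≤ ‖b j‖ := by
  have h : ∀ᶠ a in 𝓝[>] (0 : ℝ), ∀ j, b j ≠ 0 → 2 * a ≤ ‖b j‖ := by
    refine eventually_all.2 fun j => ?_
    by_cases hj : b j = 0
    · simp [hj]
    · have : (0 : ℝ) < ‖b j‖ / 2 := by positivity
      filter_upwards [nhdsWithin_le_nhds (gt_mem_nhds this)] with a ha _
      linarith
  obtain ⟨a, ha, ha'⟩ := (h.and self_mem_nhdsWithin).exists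
  exact ⟨a, ha', ha⟩

end Selection

/-! ### Passage to the limit. -/

/-- Only subadditivity is used, so the events need not be measurable. -/
theorem tendsto_measure_one {Ω : Type*} [MeasurableSpace Ω] {P : Measure Ω}
    [IsProbabilityMeasure P] {s : ℕ → Set Ω}
    (h : ∀ η > 0, ∀ᶠ n in atTop, P (s n)ᶜ ≤ ENNReal.ofReal η) :
    Tendsto (fun n => P (s n)) atTop (𝓝 1) := by
  refine tendsto_order.2 ⟨fun a ha => ?_, fun a ha => Eventually.of_forall fun n =>
    prob_le_one.trans_lt ha⟩
  have ha_top : a ≠ ⊤ := ha.ne_top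
  have ha1 : a.toReal < 1 := by
    simpa using (ENNReal.toReal_lt_toReal ha_top ENNReal.one_ne_top).2 ha
  filter_upwards [h ((1 - a.toReal) / 2) (by linarith)] with n hn
  by_contra! hcon
  have h1 : (1 : ENNReal) ≤ a + ENNReal.ofReal ((1 - a.toReal) / 2) := by
    calc (1 : ENNReal) = P (s n ∪ (s n)ᶜ) := by rw [Set.union_compl_self, measure_univ]
      _ ≤ _ := (measure_union_le _ _).trans (add_le_add hcon hn)
  have h2 := ENNReal.toReal_mono (by finiteness) h1
  rw [ENNReal.toReal_add ha_top ENNReal.ofReal_ne_top, ENNReal.toReal_ofReal (by linarith),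
    ENNReal.toReal_one] at h2
  linarith

theorem theorem2 {Ω : Type*} [MeasurableSpace Ω] (P : Measure Ω) [IsProbabilityMeasure P]
    (p : ℕ) (d : Fin p → ℕ) (τ γ : ℝ) (hτ₀ : 0 < τ) (hτ₁ : τ < 1) (hγ : 0 < γ)
    (X : (n : ℕ) → Fin n → GroupedVec d) (b₀ : GroupedVec d) (ε : ℕ → Ω → ℝ)
    (f : ℝ → ℝ) (B : Set ℝ) (U : Matrix (Σ j, Fin (d j)) (Σ j, Fin (d j)) ℝ)
    (hX : DesignAssumption X U) (hε : ErrorAssumption P ε τ f B X U)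
    (μ : ℕ → ℝ) (hμ : Tendsto μ atTop atTop)
    (hμ_sqrt : Tendsto (fun n : ℕ => μ n / √(n : ℝ)) atTop (𝓝 0))
    (hμ_weight : Tendsto (fun n : ℕ => (n : ℝ) ^ ((γ - 1) / 2) * μ n) atTop atTop)
    (hμ_sparse : Tendsto (fun n : ℕ => (n : ℝ) ^ (γ / 2 - 1) * μ n) atTop atTop)
    (bt bs : ℕ → Ω → GroupedVec d)
    (hbt_meas : ∀ n, AEMeasurable (bt n) P) (hbs_meas : ∀ n, AEMeasurable (bs n) P)
    (hbt : ∀ n, ∀ᵐ ω ∂P, IsQuantileEstimate τ (X n) (response (X n) b₀ ε ω) (bt n ω))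
    (hbs : ∀ n, ∀ᵐ ω ∂P, IsAdaptiveGroupLassoEstimate τ γ (μ n) (X n) (response (X n) b₀ ε ω)
      (bt n ω) (bs n ω)) :
    Tendsto (fun n : ℕ => P {ω | activeGroups (bs n ω) = activeGroups b₀}) atTop (𝓝 1) := by
  obtain ⟨V, hV, hV0, hfV, hfpos, hdensity⟩ := hε.density
  have hprob : IsProbabilityMeasure (P.map (ε 0)) :=
    Measure.isProbabilityMeasure_map (hε.identDistrib 0).aemeasurable_fst
  obtain ⟨δ, hδ, m, hm, M, hM, hdens⟩ := exists_density_bounds hV hV0 hfV hfpos hdensity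
  have hatom : (P.map (ε 0)).real {0} = 0 := by
    have h := (hdens {0} (measurableSet_singleton 0) (by simp [hδ.le])).2
    rw [measureReal_def (μ := volume), Real.volume_singleton, ENNReal.toReal_zero, mul_zero] at h
    exact le_antisymm h measureReal_nonneg
  have hmean := integral_checkScore hε.quantile hatom
  obtain ⟨c, hc, hlow⟩ := hX.exists_sq_le_sum
  obtain ⟨a, ha, hab₀⟩ := exists_pos_le_norm_of_ne_zero b₀
  refine tendsto_measure_one fun η hη => ?_
  -- `C` depends on `η` but not on `n`; the remaining requirements are deterministic and hold for
  -- large `n`.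
  obtain ⟨C, hC, hgrowth⟩ := exists_radius_growth hε.indep hε.identDistrib hτ₀ hτ₁ hmean hδ hm hM
    hdens (fun r hr => hX.eventually_norm_scaledPred_le hr) (by positivity)
    hX.eventually_sum_norm_scaledPred_sq_le hc hlow hη
  have hCa : ∀ᶠ n : ℕ in atTop, C / √(n : ℝ) < a :=
    ((Real.tendsto_sqrt_atTop.comp tendsto_natCast_atTop_atTop).const_div_atTop C).eventually
      (gt_mem_nhds ha)
  have hμa : ∀ᶠ n : ℕ in atTop, μ n / √(n : ℝ) * (a ^ (-γ) * ∑ j, ‖b₀ j‖) < a := by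
    have h := hμ_sqrt.mul_const (a ^ (-γ) * ∑ j, ‖b₀ j‖)
    rw [zero_mul] at h
    exact h.eventually (gt_mem_nhds ha)
  filter_upwards [hgrowth, hCa, hμa, hX.eventually_sum_norm_lt hμ_sparse hC,
    hμ.eventually_ge_atTop 0, eventually_gt_atTop 0] with n h1 h2 h3 h4 h5 h6
  refine le_trans (measure_mono_ae ?_) h1
  filter_upwards [hbt n, hbs n] with ω hω₁ hω₂ hω
  by_contra hcon
  refine hω (activeGroups_eq_of_growth hτ₀ hτ₁ hγ h6 h5 hC (fun u hu => ?_) hω₁ hω₂ ha hab₀ h2 h3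
    h4)
  by_contra! hlt
  exact hcon ⟨u, hu, hlt⟩
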